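/- Let $\lambda\in\mathbb{R}$, $\lambda\neq 0$. Let $Z_0\cong\mathbb{R}$, let $\{g_t\}_{t\in\mathbb{R}}$ be the one-parameter group acting on $Z_0$ by the dilations $g_t v=e^{\lambda t}v$, and let $F=\{g_t\}\ltimes Z_0$ (a locally compact second countable group, with the product topology). Let $F$ act measurably on a standard Borel space $X$, that is, $F\times X\to X$ is a Borel measurable group action, and let $\mu$ be an $F$-invariant Borel probability measure on $X$. Then the following are equivalent: (a) the restricted action of $Z_0$ on $(X,\mu)$ is ergodic; (b) the restricted action of $Z_0$ on $(X,\mu)$ is mixing of all orders; (c) the restricted action of $Z_0$ on $(X,\mu)$ is mixing; (d) every nontrivial element of $Z_0$ acts ergodically on $(X,\mu)$. Here, for $k\ge 2$, a measure-preserving action of a topological group $G$ on $(X,\mu)$ is called *$k$-mixing* if for all real-valued $f_1,\dots,f_k\in L^k(X,\mu)$ of integral zero and all sequences $(g^{(i)}_n)_{n\in\mathbb{N}}$ in $G$, $1\le i\le k-1$, such that each of the sequences $(g^{(i)}_n)_n$ $(1\le i\le k-1)$ and $(g^{(i)}_n(g^{(j)}_n)^{-1})_n$ $(1\le i<j\le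 k-1)$ eventually leaves every compact subset of $G$, one has $$\int_X f_1(g^{(1)}_n x)\cdots f_{k-1}(g^{(k-1)}_n x)\,f_k(x)\,d\mu(x)\;\longrightarrow\;\prod_{i=1}^k\int_X f_i\,d\mu\qquad(n\to\infty).$$ The action is *mixing* if it is $2$-mixing, and *mixing of all orders* if it is $k$-mixing for every $k\ge2$. -/

import Mathlib

open MeasureTheory Filter Topology

noncomputable section

/-- A semidirect product of topological groups carries the product topology. -/
instance SemidirectProduct.instTopologicalSpaceProd {N G : Type*} [Group N] [Group G]
    {φ : G →* MulAut N} [TopologicalSpace N] [TopologicalSpace G] :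
    TopologicalSpace (N ⋊[φ] G) :=
  TopologicalSpace.induced (fun a => (a.left, a.right)) inferInstance

/-- The one-parameter group of dilations `g_t v = e^{lam t} v` of the additive group `ℝ`
(both copies of `ℝ` are written multiplicatively). -/
def dilationHom (lam : ℝ) : Multiplicative ℝ →* MulAut (Multiplicative ℝ) where
  toFun t :=
    { toFun := fun v => .ofAdd (Real.exp (lam * t.toAdd) * v.toAdd)
      invFun := fun v => .ofAdd (Real.exp (-(lam * t.toAdd)) * v.toAdd)
      left_inv := fun v => by
        simp [← mul_assoc, ← Real.exp_add]
      right_inv := fun v => by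
        simp [← mul_assoc, ← Real.exp_add]
      map_mul' := fun v w => by
        simp [mul_add] }
  map_one' := by
    ext v
    simp
  map_mul' s t := by
    ext v
    simp [mul_add, Real.exp_add, mul_assoc]

/-- The group `F = {g_t} ⋉ Z₀`, with `Z₀ = ℝ` and `g_t v = e^{lam t} v`. -/
abbrev DilationGroup (lam : ℝ) : Type :=
  Multiplicative ℝ ⋊[dilationHom lam] Multiplicative ℝ

/-- The Borel `σ`-algebra of `F`: the product `σ`-algebra of `ℝ × ℝ`, through `(v, t) ↦ v g_t`. -/
instance DilationGroup.instMeasurableSpace (lam : ℝ) : MeasurableSpace (DilationGroup lam) :=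
  MeasurableSpace.comap (fun a => (a.left.toAdd, a.right.toAdd)) inferInstance

/-- The normal subgroup `Z₀ ≅ ℝ` of `F = {g_t} ⋉ Z₀`. -/
def DilationGroup.Z₀ (lam : ℝ) : Subgroup (DilationGroup lam) :=
  (SemidirectProduct.inl : Multiplicative ℝ →* DilationGroup lam).range

/-- `k`-mixing (`k ≥ 2`) of an action of a topological group `G` on `(X, μ)`.
Here `f 1, …, f k` are functions of integral zero and `g 1, …, g (k - 1)` are sequences in `G`;
the values of `f` and `g` at other indices play no role. The functions are taken
in `L^k`, so that the product in the integrand is integrable; for `k = 2` this is `L²`. -/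
def IsMixingOfOrder (k : ℕ) (G : Type*) {X : Type*} [Group G] [TopologicalSpace G] [MulAction G X]
    [MeasurableSpace X] (μ : Measure X) : Prop :=
  ∀ (f : ℕ → X → ℝ) (g : ℕ → ℕ → G),
    (∀ i ∈ Finset.Icc 1 k, MemLp (f i) k μ ∧ ∫ x, f i x ∂μ = 0) →
    (∀ i ∈ Finset.Icc 1 (k - 1), Tendsto (g i) atTop (cocompact G)) →
    (∀ i ∈ Finset.Icc 1 (k - 1), ∀ j ∈ Finset.Icc 1 (k - 1), i < j →
      Tendsto (fun n => g i n * (g j n)⁻¹) atTop (cocompact G)) →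
    Tendsto (fun n => ∫ x, (∏ i ∈ Finset.Icc 1 (k - 1), f i (g i n • x)) * f k x ∂μ) atTop
      (𝓝 (∏ i ∈ Finset.Icc 1 k, ∫ x, f i x ∂μ))

/-- Mixing is `2`-mixing. -/
def IsMixingAction (G : Type*) {X : Type*} [Group G] [TopologicalSpace G] [MulAction G X]
    [MeasurableSpace X] (μ : Measure X) : Prop :=
  IsMixingOfOrder 2 G μ

/-- Mixing of all orders: `k`-mixing for every `k ≥ 2`. -/
def IsMixingOfAllOrders (G : Type*) {X : Type*} [Group G] [TopologicalSpace G] [MulAction G X]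
    [MeasurableSpace X] (μ : Measure X) : Prop :=
  ∀ k : ℕ, 2 ≤ k → IsMixingOfOrder k G μ

end

/-! Write `u` for the flow of `Z₀` and `D` for the dilation flow, so that `D t ∘ u s = u (exp (lam *
t) * s) ∘ D t`. Both preserve `μ`, and a measurable measure-preserving flow moves bounded functions
continuously in `L¹`. Conjugating by `D t` with `t` near `0` therefore shows that multiplying all
times `d i` in a correlation `∫ ∏ f i (u (d i) x)` by a common factor near `1` changes it little,
however large the times are. With the factor `1 + r / S`, where `|S| → ∞` and `d i / S → ρ i`, each
time moves by about `r * ρ i`, a bounded shift. Correlations are thus asymptotically invariant under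
these shifts (`tendsto_integral_prod_shift_sub`).

For two functions with times `s` and `0`, this says that every `g - g ∘ u r` decorrelates from every
`h`. A function orthogonal to all these differences is invariant, hence constant if `u` is ergodic,
so mixing follows.

For more functions, induct on their number. Along an ultrafilter, measure times from a base time and
divide by the largest such distance. The indices split into `A` (limit `ρ i = 0`) and `B` (`ρ i ≠
0`), both proper subsets. Shifting by `m * ρ i` leaves the `A`-product alone and turns the centred
`B`-product into a sequence `v m`. All `v m` have asymptotically the same inner product with the
`A`-product, while the induction hypothesis and mixing make distant `v m` nearly orthogonal.
Averaging over many `m` forces that common inner product to `0`, which separates `A` from `B`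
(`tendsto_integral_prod_ultrafilter`). Hölder's inequality extends this to `L^k`.

Conversely, mixing along the powers of `z ≠ 1` makes `z` ergodic, and ergodicity of one element
implies that of `Z₀`. -/

/-! ### Measure-preserving flows and bounded functions -/

/-- A measurable one-parameter group of measure-preserving transformations. -/
structure IsMeasurePreservingFlow {X : Type*} [MeasurableSpace X] (φ : ℝ → X → X)
    (μ : Measure X) : Prop where
  measurable : Measurable fun p : ℝ × X => φ p.1 p.2
  measurePreserving : ∀ t, MeasurePreserving (φ t) μ μ
  zero : ∀ x, φ 0 x = x
  add : ∀ s t x, φ (s + t) x = φ s (φ t x)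

/-- A bounded measurable real function. -/
structure IsBddMeasurable {X : Type*} [MeasurableSpace X] (f : X → ℝ) : Prop where
  measurable : Measurable f
  bdd : ∃ C, ∀ x, |f x| ≤ C

namespace IsBddMeasurable

variable {X Y : Type*} [MeasurableSpace X] [MeasurableSpace Y] {f g : X → ℝ}

theorem comp (hf : IsBddMeasurable f) {T : Y → X} (hT : Measurable T) :
    IsBddMeasurable fun y => f (T y) :=
  ⟨hf.1.comp hT, let ⟨C, hC⟩ := hf.2; ⟨C, fun y => hC (T y)⟩⟩

theorem const (c : ℝ) : IsBddMeasurable fun _ : X => c :=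
  ⟨measurable_const, |c|, fun _ => le_rfl⟩

theorem mul (hf : IsBddMeasurable f) (hg : IsBddMeasurable g) :
    IsBddMeasurable fun x => f x * g x := by
  obtain ⟨C, hC⟩ := hf.2
  obtain ⟨D, hD⟩ := hg.2
  refine ⟨hf.1.mul hg.1, C * D, fun x => ?_⟩
  rw [abs_mul]
  exact mul_le_mul (hC x) (hD x) (abs_nonneg _) ((abs_nonneg _).trans (hC x))

theorem sub (hf : IsBddMeasurable f) (hg : IsBddMeasurable g) :
    IsBddMeasurable fun x => f x - g x := by
  obtain ⟨C, hC⟩ := hf.2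
  obtain ⟨D, hD⟩ := hg.2
  exact ⟨hf.1.sub hg.1, C + D, fun x => (abs_sub _ _).trans (add_le_add (hC x) (hD x))⟩

theorem abs (hf : IsBddMeasurable f) : IsBddMeasurable fun x => |f x| := by
  obtain ⟨C, hC⟩ := hf.2
  exact ⟨hf.1.abs, C, fun x => by simpa using hC x⟩

theorem prod {ι : Type*} (s : Finset ι) {f : ι → X → ℝ} (hf : ∀ i, IsBddMeasurable (f i)) :
    IsBddMeasurable fun x => ∏ i ∈ s, f i x := by
  classical
  induction s using Finset.induction_on with
  | empty => simpa using const 1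
  | insert a s ha ih =>
    simp only [Finset.prod_insert ha]
    exact (hf a).mul ih

theorem integrable (hf : IsBddMeasurable f) (μ : Measure X) [IsFiniteMeasure μ] :
    Integrable f μ := by
  obtain ⟨C, hC⟩ := hf.2
  exact .of_bound hf.1.aestronglyMeasurable C (.of_forall hC)

theorem memLp (hf : IsBddMeasurable f) (p : ENNReal) (μ : Measure X) [IsFiniteMeasure μ] :
    MemLp f p μ := by
  obtain ⟨C, hC⟩ := hf.2
  exact .of_bound hf.1.aestronglyMeasurable C (.of_forall hC)

end IsBddMeasurable

theorem MeasureTheory.MeasurePreserving.integral_comp_of_measurable {X : Type*} [MeasurableSpace X]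
    {μ : Measure X} {T : X → X} (hT : MeasurePreserving T μ μ) {f : X → ℝ} (hf : Measurable f) :
    ∫ x, f (T x) ∂μ = ∫ x, f x ∂μ := by
  rw [← integral_map hT.measurable.aemeasurable hf.aestronglyMeasurable, hT.map_eq]

/-! ### Continuity of measurable flows in `L¹` -/

/-- Continuity of translations in `L¹(ℝ)`. -/
theorem tendsto_integral_abs_comp_add_sub {ψ : ℝ → ℝ} (hψ : Integrable ψ) :
    Tendsto (fun h => ∫ t, |ψ (t + h) - ψ t|) (𝓝 0) (𝓝 0) := by
  have hmp : ∀ h : ℝ, MeasurePreserving (fun t : ℝ => t + h) volume volume :=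
    fun h => measurePreserving_add_right volume h
  have hm : MemLp ψ 1 volume := memLp_one_iff_integrable.2 hψ
  -- Currying makes the translations a continuous family in the compact-open topology, and
  -- composition with such a family of measure-preserving maps is continuous on `L¹`.
  let g : C(ℝ, C(ℝ, ℝ)) := (ContinuousMap.mk (fun a : ℝ × ℝ => a.2 + a.1) (by fun_prop)).curry
  have hg : Tendsto g (𝓝 0) (𝓝 (g 0)) := g.continuous.tendsto 0
  have key := Filter.Tendsto.compMeasurePreservingLp (l := 𝓝 (0 : ℝ))
    (f := fun _ => hm.toLp ψ) (f₀ := hm.toLp ψ) (g := g) (g₀ := g 0) tendsto_const_nhds hg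
    (fun h => hmp h) (hmp 0) ENNReal.one_ne_top
  rw [tendsto_iff_norm_sub_tendsto_zero] at key
  refine key.congr fun h => ?_
  rw [L1.norm_eq_integral_norm]
  refine integral_congr_ae ?_
  have e1 := Lp.coeFn_compMeasurePreserving (hm.toLp ψ) (hmp h)
  have e2 := Lp.coeFn_compMeasurePreserving (hm.toLp ψ) (hmp 0)
  have e3 := hm.coeFn_toLp
  filter_upwards [Lp.coeFn_sub (Lp.compMeasurePreserving _ (hmp h) (hm.toLp ψ))
    (Lp.compMeasurePreserving _ (hmp 0) (hm.toLp ψ)), e1, e2, e3,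
    (hmp h).quasiMeasurePreserving.ae e3, (hmp 0).quasiMeasurePreserving.ae e3]
    with t h0 h1 h2 h3 h4 h5
  rw [Real.norm_eq_abs]
  erw [h0]
  rw [Pi.sub_apply, h1, h2]
  simp only [Function.comp] at *
  rw [h4, h5, add_zero]

theorem tendsto_setIntegral_abs_comp_add_sub {ψ : ℝ → ℝ} (hψ : IsBddMeasurable ψ) :
    Tendsto (fun h => ∫ t in Set.Icc (0 : ℝ) 1, |ψ (t + h) - ψ t|) (𝓝 0) (𝓝 0) := by
  -- `ψ` need not be integrable on `ℝ`; the window `[-1, 2]` contains `t + h` whenever `t ∈ [0, 1]`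
  -- and `|h| ≤ 1`.
  set χ : ℝ → ℝ := (Set.Icc (-1 : ℝ) 2).indicator ψ with hχ
  have hχi : Integrable χ := by
    rw [hχ, integrable_indicator_iff measurableSet_Icc]
    exact hψ.integrable _
  refine squeeze_zero' (.of_forall fun h => integral_nonneg fun _ => abs_nonneg _) ?_
    (tendsto_integral_abs_comp_add_sub hχi)
  filter_upwards [Icc_mem_nhds (show (-1 : ℝ) < 0 by norm_num) (show (0 : ℝ) < 1 by norm_num)]
    with h hh
  have e : ∫ t in Set.Icc (0 : ℝ) 1, |ψ (t + h) - ψ t|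
      = ∫ t in Set.Icc (0 : ℝ) 1, |χ (t + h) - χ t| := by
    refine setIntegral_congr_fun measurableSet_Icc fun t ht => ?_
    have h1 : t + h ∈ Set.Icc (-1 : ℝ) 2 := ⟨by linarith [ht.1, hh.1], by linarith [ht.2, hh.2]⟩
    have h2 : t ∈ Set.Icc (-1 : ℝ) 2 := ⟨by linarith [ht.1], by linarith [ht.2]⟩
    simp only [hχ, Set.indicator_of_mem h1, Set.indicator_of_mem h2]
  rw [e]
  exact setIntegral_le_integral ((hχi.comp_add_right h).sub hχi).abs
    (.of_forall fun _ => abs_nonneg _)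

namespace IsMeasurePreservingFlow

variable {X : Type*} [MeasurableSpace X] {μ : Measure X} {φ : ℝ → X → X}

/-- A measurable flow acts continuously in `L¹`. -/
theorem tendsto_integral_abs_sub_zero [IsProbabilityMeasure μ] (hφ : IsMeasurePreservingFlow φ μ)
    {f : X → ℝ} (hf : IsBddMeasurable f) :
    Tendsto (fun h => ∫ x, |f (φ h x) - f x| ∂μ) (𝓝 0) (𝓝 0) := by
  have hbdd : ∀ h : ℝ, IsBddMeasurable
      fun p : X × ℝ => |f (φ (p.2 + h) p.1) - f (φ p.2 p.1)| := fun h =>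
    ((hf.comp (T := fun p : X × ℝ => φ (p.2 + h) p.1)
        (hφ.measurable.comp (by fun_prop : Measurable fun p : X × ℝ => (p.2 + h, p.1)))).sub
      (hf.comp (T := fun p : X × ℝ => φ p.2 p.1)
        (hφ.measurable.comp (by fun_prop : Measurable fun p : X × ℝ => (p.2, p.1))))).abs
  obtain ⟨C, hC⟩ := hf.2
  -- Averaging over the orbit segment `t ∈ [0, 1]` costs nothing, since by invariance the integral
  -- over `x` does not depend on `t`; for fixed `x` it is continuity of translations on the line.
  have key : Tendsto (fun h => ∫ x, (∫ t in Set.Icc (0 : ℝ) 1,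
      |f (φ (t + h) x) - f (φ t x)|) ∂μ) (𝓝 0) (𝓝 (∫ _, (0 : ℝ) ∂μ)) := by
    refine tendsto_integral_filter_of_dominated_convergence (fun _ => 2 * C) ?_ ?_
      (integrable_const _) ?_
    · exact .of_forall fun h =>
        ((hbdd h).1.stronglyMeasurable.integral_prod_right').aestronglyMeasurable
    · refine .of_forall fun h => .of_forall fun x => ?_
      have := norm_setIntegral_le_of_norm_le_const (μ := volume) (s := Set.Icc (0 : ℝ) 1)
        (f := fun t => |f (φ (t + h) x) - f (φ t x)|) (C := 2 * C) (by simp) (fun t _ => by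
          rw [Real.norm_eq_abs, abs_abs]
          exact (abs_sub _ _).trans (by linarith [hC (φ (t + h) x), hC (φ t x)]))
      simpa using this
    · exact .of_forall fun x => tendsto_setIntegral_abs_comp_add_sub
        (hf.comp (hφ.measurable.comp (by fun_prop : Measurable fun t : ℝ => (t, x))))
  rw [integral_zero] at key
  refine key.congr fun h => ?_
  rw [integral_integral_swap ((hbdd h).integrable (μ.prod (volume.restrict (Set.Icc 0 1))))]
  have : ∀ t, ∫ x, |f (φ (t + h) x) - f (φ t x)| ∂μ = ∫ x, |f (φ h x) - f x| ∂μ := fun t => by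
    rw [← (hφ.measurePreserving t).integral_comp_of_measurable
      (f := fun x => |f (φ h x) - f x|)
      ((hf.comp (hφ.measurePreserving h).measurable).sub hf).abs.1]
    simp only [← hφ.add, add_comm]
  simp [this]

theorem tendsto_integral_abs_sub [IsProbabilityMeasure μ] (hφ : IsMeasurePreservingFlow φ μ)
    {f : X → ℝ} (hf : IsBddMeasurable f) (r : ℝ) :
    Tendsto (fun h => ∫ x, |f (φ h x) - f (φ r x)| ∂μ) (𝓝 r) (𝓝 0) := by
  have h1 : Tendsto (fun h => h - r) (𝓝 r) (𝓝 0) := by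
    simpa using (continuous_sub_right r).tendsto r
  refine ((hφ.tendsto_integral_abs_sub_zero hf).comp h1).congr fun h => ?_
  simp only [Function.comp]
  rw [← (hφ.measurePreserving r).integral_comp_of_measurable
    (f := fun x => |f (φ (h - r) x) - f x|)
    ((hf.comp (hφ.measurePreserving (h - r)).measurable).sub hf).abs.1]
  simp only [← hφ.add, sub_add_cancel]

end IsMeasurePreservingFlow

/-! ### Stability of multiple correlations -/

/-- Exchange the factors one at a time. Since `1 ≤ C`, the single power `C ^ s.card` dominates every
partial product. -/
theorem Finset.abs_prod_sub_prod_le {ι : Type*} (s : Finset ι) (a b : ι → ℝ) {C : ℝ} (hC : 1 ≤ C)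
    (ha : ∀ i ∈ s, |a i| ≤ C) (hb : ∀ i ∈ s, |b i| ≤ C) :
    |∏ i ∈ s, a i - ∏ i ∈ s, b i| ≤ C ^ s.card * ∑ i ∈ s, |a i - b i| := by
  classical
  induction s using Finset.induction_on with
  | empty => simp
  | insert j s hj ih =>
    have ih' := ih (fun i hi => ha i (mem_insert_of_mem hi)) (fun i hi => hb i (mem_insert_of_mem hi))
    have hC0 : 0 ≤ C := zero_le_one.trans hC
    have hB : |∏ i ∈ s, b i| ≤ C ^ s.card := by
      rw [abs_prod]
      exact (prod_le_prod (fun _ _ => abs_nonneg _) fun i hi => hb i (mem_insert_of_mem hi)).trans_eq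
        (by simp)
    have hS : 0 ≤ ∑ i ∈ s, |a i - b i| := sum_nonneg fun _ _ => abs_nonneg _
    rw [prod_insert hj, prod_insert hj, sum_insert hj, card_insert_of_notMem hj]
    have hp : C ^ s.card ≤ C ^ (s.card + 1) := pow_le_pow_right₀ hC (Nat.le_succ _)
    calc |a j * ∏ i ∈ s, a i - b j * ∏ i ∈ s, b i|
        = |a j * (∏ i ∈ s, a i - ∏ i ∈ s, b i) + (a j - b j) * ∏ i ∈ s, b i| := by ring_nf
      _ ≤ |a j| * |∏ i ∈ s, a i - ∏ i ∈ s, b i| + |a j - b j| * |∏ i ∈ s, b i| := by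
          rw [← abs_mul, ← abs_mul]; exact abs_add_le _ _
      _ ≤ C * (C ^ s.card * ∑ i ∈ s, |a i - b i|) + |a j - b j| * C ^ (s.card + 1) := by
          gcongr
          · exact ha j (mem_insert_self _ _)
          · exact hB.trans hp
      _ = _ := by ring

/-- Changing bounded functions by a small amount in `L¹` changes the integral of a product of
translates by a small amount, uniformly in the translations. -/
theorem tendsto_integral_prod_comp_sub {X α ι : Type*} [MeasurableSpace X] {μ : Measure X}
    [IsProbabilityMeasure μ] {l : Filter α} (s : Finset ι) {f : ι → α → X → ℝ} {g : ι → X → ℝ}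
    {T : ι → α → X → X} {C : ℝ} (hf : ∀ i n, Measurable (f i n)) (hg : ∀ i, Measurable (g i))
    (hfC : ∀ i n x, |f i n x| ≤ C) (hgC : ∀ i x, |g i x| ≤ C)
    (hT : ∀ i n, MeasurePreserving (T i n) μ μ)
    (hlim : ∀ i ∈ s, Tendsto (fun n => ∫ x, |f i n x - g i x| ∂μ) l (𝓝 0)) :
    Tendsto (fun n => ∫ x, ∏ i ∈ s, f i n (T i n x) ∂μ - ∫ x, ∏ i ∈ s, g i (T i n x) ∂μ) l
      (𝓝 0) := by
  have hf' : ∀ i n, IsBddMeasurable (f i n) := fun i n => ⟨hf i n, C, hfC i n⟩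
  have hg' : ∀ i, IsBddMeasurable (g i) := fun i => ⟨hg i, C, hgC i⟩
  have hb : Tendsto (fun n => (max C 1) ^ s.card * ∑ i ∈ s, ∫ x, |f i n x - g i x| ∂μ) l (𝓝 0) := by
    simpa using (tendsto_finsetSum s hlim).const_mul ((max C 1) ^ s.card)
  refine squeeze_zero_norm (fun n => ?_) hb
  have hF := fun i => (hf' i n).comp (hT i n).measurable
  have hG := fun i => (hg' i).comp (hT i n).measurable
  rw [← integral_sub ((IsBddMeasurable.prod s hF).integrable μ)
    ((IsBddMeasurable.prod s hG).integrable μ)]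
  have hsum : ∑ i ∈ s, ∫ x, |f i n x - g i x| ∂μ
      = ∫ x, ∑ i ∈ s, |f i n (T i n x) - g i (T i n x)| ∂μ := by
    rw [integral_finsetSum _ fun i _ => ((hF i).sub (hG i)).abs.integrable μ]
    exact Finset.sum_congr rfl fun i _ => ((hT i n).integral_comp_of_measurable
      (f := fun x => |f i n x - g i x|) ((hf' i n).sub (hg' i)).abs.1).symm
  rw [hsum, ← integral_const_mul]
  refine (norm_integral_le_integral_norm _).trans (integral_mono
    (((IsBddMeasurable.prod s hF).sub (IsBddMeasurable.prod s hG)).abs.integrable μ)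
    ((integrable_finsetSum _ fun i _ => ((hF i).sub (hG i)).abs.integrable μ).const_mul _)
    fun x => ?_)
  exact s.abs_prod_sub_prod_le _ _ (le_max_right _ _)
    (fun i _ => (hfC i n _).trans (le_max_left _ _)) fun i _ => (hgC i _).trans (le_max_left _ _)

/-! ### Renormalization and asymptotic shift invariance -/

/-- The flow `D` renormalizes the flow `u`, with exponent `lam ≠ 0`. -/
structure IsRenormalizedFlow {X : Type*} [MeasurableSpace X] (u D : ℝ → X → X) (lam : ℝ)
    (μ : Measure X) : Prop where
  flow : IsMeasurePreservingFlow u μ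
  dilation : IsMeasurePreservingFlow D μ
  ne_zero : lam ≠ 0
  conj : ∀ t s x, D t (u s x) = u (Real.exp (lam * t) * s) (D t x)

namespace IsRenormalizedFlow

variable {X : Type*} [MeasurableSpace X] {μ : Measure X} [IsProbabilityMeasure μ]
  {u D : ℝ → X → X} {lam : ℝ}

/-- Multiplying all times by a factor close to `1` does not change multiple correlations much. -/
theorem tendsto_integral_prod_mul_sub (hu : IsRenormalizedFlow u D lam μ) {α ι : Type*}
    {l : Filter α} (s : Finset ι) {f : ι → X → ℝ} {C : ℝ} (hf : ∀ i, Measurable (f i))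
    (hC : ∀ i x, |f i x| ≤ C) {c : α → ℝ} (hc : Tendsto c l (𝓝 1)) (d : ι → α → ℝ) :
    Tendsto (fun n => ∫ x, ∏ i ∈ s, f i (u (c n * d i n) x) ∂μ
      - ∫ x, ∏ i ∈ s, f i (u (d i n) x) ∂μ) l (𝓝 0) := by
  -- Chosen so that `exp (lam * t n) = c n` once `c n > 0`.
  set t : α → ℝ := fun n => Real.log (c n) / lam with ht
  have ht0 : Tendsto t l (𝓝 0) := by
    have := ((Real.continuousAt_log one_ne_zero).tendsto.comp hc).div_const lam
    simpa using this
  have key := tendsto_integral_prod_comp_sub (μ := μ) (l := l) s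
    (f := fun i n x => f i (D (t n) x)) (g := f) (T := fun i n => u (d i n)) (C := C)
    (fun i n => (hf i).comp (hu.dilation.measurePreserving _).measurable) hf
    (fun i n x => hC i _) hC (fun i n => hu.flow.measurePreserving _)
    (fun i _ => (hu.dilation.tendsto_integral_abs_sub_zero ⟨hf i, C, hC i⟩).comp ht0)
  refine key.congr' ?_
  filter_upwards [hc.eventually (lt_mem_nhds one_pos)] with n hn
  congr 1
  rw [← (hu.dilation.measurePreserving (t n)).integral_comp_of_measurable
    (f := fun x => ∏ i ∈ s, f i (u (c n * d i n) x))
    (Finset.measurable_fun_prod _ fun i _ =>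
      (hf i).comp (hu.flow.measurePreserving _).measurable)]
  have hexp : Real.exp (lam * t n) = c n := by
    rw [ht, mul_div_cancel₀ _ hu.ne_zero, Real.exp_log hn]
  simp only [hu.conj, hexp]

/-- Asymptotic invariance of multiple correlations: if the times `d i` grow like `ρ i * S`, then
the correlations do not change when the `i`-th function is shifted by time `r * ρ i`. -/
theorem tendsto_integral_prod_shift_sub (hu : IsRenormalizedFlow u D lam μ) {α ι : Type*}
    {l : Filter α} (s : Finset ι) {f : ι → X → ℝ} {C : ℝ} (hf : ∀ i, Measurable (f i))
    (hC : ∀ i x, |f i x| ≤ C) {S : α → ℝ} (hS : Tendsto S l (cocompact ℝ)) {d : ι → α → ℝ}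
    {ρ : ι → ℝ} (hd : ∀ i ∈ s, Tendsto (fun n => d i n / S n) l (𝓝 (ρ i))) (r : ℝ) :
    Tendsto (fun n => ∫ x, ∏ i ∈ s, f i (u (r * ρ i) (u (d i n) x)) ∂μ
      - ∫ x, ∏ i ∈ s, f i (u (d i n) x) ∂μ) l (𝓝 0) := by
  -- The factor `1 + r / S` sends `d i` to `d i + r * (d i / S)`. `h1` compares these times with `d
  -- i`, and `h2` replaces the shift by its limit `r * ρ i`.
  have hc : Tendsto (fun n => 1 + r * (S n)⁻¹) l (𝓝 1) := by
    have := (((tendsto_inv₀_cobounded (α := ℝ)).comp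
      (Metric.cobounded_eq_cocompact (α := ℝ) ▸ hS))).const_mul r
    simpa using this.const_add 1
  have h1 := hu.tendsto_integral_prod_mul_sub s hf hC hc d
  have h2 := tendsto_integral_prod_comp_sub (μ := μ) (l := l) s
    (f := fun i n x => f i (u (r * (d i n / S n)) x)) (g := fun i x => f i (u (r * ρ i) x))
    (T := fun i n => u (d i n)) (C := C)
    (fun i n => (hf i).comp (hu.flow.measurePreserving _).measurable)
    (fun i => (hf i).comp (hu.flow.measurePreserving _).measurable)
    (fun i n x => hC i _) (fun i x => hC i _) (fun i n => hu.flow.measurePreserving _)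
    (fun i hi => (hu.flow.tendsto_integral_abs_sub ⟨hf i, C, hC i⟩ (r * ρ i)).comp
      ((hd i hi).const_mul r))
  have h3 := h1.sub h2
  rw [sub_zero] at h3
  refine h3.congr fun n => ?_
  have e : ∀ i, (1 + r * (S n)⁻¹) * d i n = r * (d i n / S n) + d i n := fun i => by ring
  simp only [e, hu.flow.add]
  ring

end IsRenormalizedFlow

/-! ### Two Hilbert space lemmas -/

/-- A vector family asymptotically orthogonal to its own shifts tends weakly to zero. -/
theorem tendsto_inner_zero_of_correlations {α H : Type*} [NormedAddCommGroup H]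
    [InnerProductSpace ℝ H] {l : Filter α} {h : α → H} {C : ℝ} (hC : ∀ n, ‖h n‖ ≤ C)
    {v : ℕ → α → H}
    (hv : ∀ m, Tendsto (fun n => inner ℝ (h n) (v m n) - inner ℝ (h n) (v 0 n)) l (𝓝 0))
    {a : ℕ → ℕ → ℝ} (ha : ∀ m m', Tendsto (fun n => inner ℝ (v m n) (v m' n)) l (𝓝 (a m m')))
    {M : ℝ} (hM : ∀ m, a m m ≤ M)
    (hsep : ∀ ε > 0, ∃ R : ℕ, ∀ m m', m ≠ m' → a (R * m) (R * m') ≤ ε) :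
    Tendsto (fun n => inner ℝ (h n) (v 0 n)) l (𝓝 0) := by
  wlog hC0 : 0 < C generalizing C
  · exact this (C := max C 1) (fun n => (hC n).trans (le_max_left _ _)) (by positivity)
  rw [Metric.tendsto_nhds]
  intro ε hε
  -- The average `G` below will have norm less than `δ`, whence `|⟪h, G⟫| ≤ C * δ = ε / 2`.
  set δ := ε / (2 * C) with hδ
  have hδ0 : 0 < δ := by positivity
  obtain ⟨R, hR⟩ := hsep (δ ^ 2 / 3) (by positivity)
  obtain ⟨K, hK⟩ := exists_nat_gt (3 * |M| / δ ^ 2)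
  set N : ℕ := K + 1 with hN
  have hNpos : (0 : ℝ) < N := by positivity
  have hMN : |M| < N * (δ ^ 2 / 3) := by
    rw [div_lt_iff₀ (by positivity)] at hK
    have : (K : ℝ) ≤ N := by simp [hN]
    nlinarith [sq_nonneg δ]
  -- Average of `N` vectors with indices spaced by `R`. In the limit of `‖G‖ ^ 2` the off-diagonal
  -- terms contribute at most `δ ^ 2 / 3` and the diagonal at most `|M| / N < δ ^ 2 / 3`.
  set G : α → H := fun n => (N : ℝ)⁻¹ • ∑ m ∈ Finset.range N, v (R * m) n with hG
  have hG2 : Tendsto (fun n => ‖G n‖ ^ 2) l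
      (𝓝 ((N : ℝ)⁻¹ ^ 2 * ∑ m ∈ Finset.range N, ∑ m' ∈ Finset.range N, a (R * m) (R * m'))) := by
    have e : ∀ n, ‖G n‖ ^ 2 = (N : ℝ)⁻¹ ^ 2 * ∑ m ∈ Finset.range N, ∑ m' ∈ Finset.range N,
        inner ℝ (v (R * m) n) (v (R * m') n) := fun n => by
      rw [← real_inner_self_eq_norm_sq, hG, inner_smul_left, inner_smul_right, sum_inner]
      simp only [inner_sum, conj_trivial]
      ring
    simp only [e]
    exact (tendsto_finsetSum _ fun m _ => tendsto_finsetSum _ fun m' _ => ha _ _).const_mul _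
  have hlim : (N : ℝ)⁻¹ ^ 2 * ∑ m ∈ Finset.range N, ∑ m' ∈ Finset.range N, a (R * m) (R * m')
      < δ ^ 2 := by
    have hb : ∑ m ∈ Finset.range N, ∑ m' ∈ Finset.range N, a (R * m) (R * m')
        ≤ ∑ m ∈ Finset.range N, ∑ m' ∈ Finset.range N,
          (δ ^ 2 / 3 + if m = m' then |M| else 0) := by
      refine Finset.sum_le_sum fun m _ => Finset.sum_le_sum fun m' _ => ?_
      split_ifs with hmm
      · subst hmm
        exact (hM _).trans ((le_abs_self M).trans (by simp; positivity))
      · simpa using hR m m' hmm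
    have hs : ∑ m ∈ Finset.range N, ∑ m' ∈ Finset.range N,
          (δ ^ 2 / 3 + if m = m' then |M| else 0) = N ^ 2 * (δ ^ 2 / 3) + N * |M| := by
      simp only [Finset.sum_add_distrib, Finset.sum_ite_eq, Finset.sum_const, Finset.card_range,
        nsmul_eq_mul]
      rw [Finset.sum_congr rfl fun m hm => if_pos hm]
      simp only [Finset.sum_const, Finset.card_range, nsmul_eq_mul]
      ring
    rw [hs] at hb
    calc _ ≤ (N : ℝ)⁻¹ ^ 2 * (N ^ 2 * (δ ^ 2 / 3) + N * |M|) := by gcongr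
      _ < (N : ℝ)⁻¹ ^ 2 * (N ^ 2 * (δ ^ 2 / 3) + N * (N * (δ ^ 2 / 3))) := by gcongr
      _ = 2 / 3 * δ ^ 2 := by field_simp; ring
      _ < δ ^ 2 := by nlinarith [pow_pos hδ0 2]
  have hdiff : Tendsto (fun n => inner ℝ (h n) (G n) - inner ℝ (h n) (v 0 n)) l (𝓝 0) := by
    have h0 := (tendsto_finsetSum (Finset.range N) fun m _ => hv (R * m)).const_mul (N : ℝ)⁻¹
    simp only [Finset.sum_const_zero, mul_zero] at h0
    refine h0.congr fun n => ?_
    rw [hG, inner_smul_right, inner_sum, Finset.sum_sub_distrib, Finset.sum_const,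
      Finset.card_range, nsmul_eq_mul]
    field_simp
  filter_upwards [hG2.eventually (gt_mem_nhds hlim),
    (Metric.tendsto_nhds.1 hdiff) (ε / 2) (by positivity)] with n h1 h2
  have h3 : ‖G n‖ < δ := lt_of_pow_lt_pow_left₀ 2 hδ0.le h1
  have h4 : |inner ℝ (h n) (G n)| ≤ C * δ :=
    (abs_real_inner_le_norm _ _).trans (mul_le_mul (hC n) h3.le (norm_nonneg _) hC0.le)
  have h5 : C * δ = ε / 2 := by rw [hδ]; field_simp
  rw [Real.dist_eq, sub_zero] at h2 ⊢
  rw [abs_lt] at h2 ⊢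
  rw [h5, abs_le] at h4
  constructor <;> linarith [h2.1, h2.2, h4.1, h4.2]

/-- Weak convergence to zero under a family of isometries passes from a set of vectors to every
vector orthogonal to its orthogonal complement. -/
theorem tendsto_inner_isometry_of_orthogonal {α H : Type*} [NormedAddCommGroup H]
    [InnerProductSpace ℝ H] [CompleteSpace H] {l : Filter α} (U : α → H →ₗᵢ[ℝ] H) (h : H)
    {V : Set H} (hV : ∀ v ∈ V, Tendsto (fun s => inner ℝ (U s v) h) l (𝓝 0)) {F : H}
    (hF : ∀ w, (∀ v ∈ V, inner ℝ v w = 0) → inner ℝ w F = 0) :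
    Tendsto (fun s => inner ℝ (U s F) h) l (𝓝 0) := by
  -- The vectors with the desired limit form a subspace, closed because the `U s` are isometries;
  -- hence it equals its double orthogonal complement. It contains `V`, so it contains `F`.
  let W : Submodule ℝ H :=
    { carrier := {f | Tendsto (fun s => inner ℝ (U s f) h) l (𝓝 0)}
      zero_mem' := by simpa using tendsto_const_nhds
      add_mem' := fun {f g} hf hg => by
        simpa [inner_add_left] using Tendsto.add hf hg
      smul_mem' := fun c f hf => by
        simpa [inner_smul_left] using Tendsto.const_mul c hf }
  have hclosed : IsClosed (W : Set H) := by
    rw [← isSeqClosed_iff_isClosed]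
    intro f f₀ hf hlim
    change Tendsto _ _ _
    rw [Metric.tendsto_nhds]
    intro ε hε
    obtain ⟨n, hn⟩ := ((Metric.tendsto_atTop.1 hlim) (ε / (2 * (‖h‖ + 1))) (by positivity))
    have hn := hn n le_rfl
    filter_upwards [(Metric.tendsto_nhds.1 (show Tendsto _ _ _ from hf n)) (ε / 2) (by positivity)]
      with s hs
    rw [Real.dist_eq, sub_zero] at hs ⊢
    have e : inner ℝ (U s f₀) h = inner ℝ (U s (f n)) h - inner ℝ (U s (f n - f₀)) h := by
      rw [map_sub, inner_sub_left]; ring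
    have b : |inner ℝ (U s (f n - f₀)) h| ≤ ε / 2 := by
      refine (abs_real_inner_le_norm _ _).trans ?_
      rw [LinearIsometry.norm_map]
      rw [dist_eq_norm, lt_div_iff₀ (by positivity)] at hn
      nlinarith [norm_nonneg (f n - f₀), norm_nonneg h]
    rw [e]
    exact (abs_sub _ _).trans_lt (by linarith)
  have : CompleteSpace W := hclosed.completeSpace_coe
  change F ∈ W
  rw [← W.orthogonal_orthogonal, Submodule.mem_orthogonal]
  intro w hw
  rw [Submodule.mem_orthogonal] at hw
  exact hF w fun v hv => hw v (hV v hv)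

/-! ### Ergodicity implies mixing -/

namespace IsMeasurePreservingFlow

variable {X : Type*} [MeasurableSpace X] {μ : Measure X} {u : ℝ → X → X}

/-- An integrable function orthogonal to all `f - f ∘ u r` is invariant. -/
theorem ae_eq_comp_of_integral_mul_sub_eq_zero (hu : IsMeasurePreservingFlow u μ) {w : X → ℝ}
    (hwm : StronglyMeasurable w) (hwi : Integrable w μ)
    (hw : ∀ f : X → ℝ, IsBddMeasurable f → ∀ r, ∫ x, (f x - f (u r x)) * w x ∂μ = 0) (r : ℝ) :
    (fun x => w (u r x)) =ᵐ[μ] w := by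
  have hwr : Integrable (fun x => w (u r x)) μ :=
    (hu.measurePreserving r).integrable_comp_of_integrable hwi
  refine Integrable.ae_eq_of_forall_setIntegral_eq _ _ hwr hwi fun A hA _ => ?_
  set f : X → ℝ := A.indicator 1 with hf
  have hfb : IsBddMeasurable f := ⟨measurable_one.indicator hA, 1, fun x => by
    by_cases hx : x ∈ A <;> simp [hf, hx]⟩
  have hfr := hfb.comp (hu.measurePreserving (-r)).measurable
  have i1 : Integrable (fun x => f x * w x) μ := by
    obtain ⟨C, hC⟩ := hfb.2
    exact hwi.bdd_mul hfb.1.aestronglyMeasurable (.of_forall hC)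
  have i2 : Integrable (fun x => f (u (-r) x) * w x) μ := by
    obtain ⟨C, hC⟩ := hfr.2
    exact hwi.bdd_mul hfr.1.aestronglyMeasurable (.of_forall hC)
  -- Testing with `-r` gives `∫ f * w = ∫ (f ∘ u (-r)) * w`, and the latter equals `∫ f * (w ∘ u r)`
  -- by invariance.
  have h0 := hw f hfb (-r)
  simp only [sub_mul] at h0
  rw [integral_sub i1 i2, sub_eq_zero] at h0
  have e : ∀ g : X → ℝ, ∫ x in A, g x ∂μ = ∫ x, f x * g x ∂μ := fun g => by
    rw [← integral_indicator hA]
    refine integral_congr_ae (.of_forall fun x => ?_)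
    by_cases hx : x ∈ A <;> simp [hf, hx]
  rw [e, e, h0, ← (hu.measurePreserving r).integral_comp_of_measurable
    (f := fun x => f (u (-r) x) * w x) (hfr.1.mul hwm.measurable)]
  simp only [← hu.add, neg_add_cancel, hu.zero]

/-- An invariant function of an ergodic flow is constant. -/
theorem exists_ae_eq_const (herg : ∀ A : Set X, MeasurableSet A →
      (∀ r, u r ⁻¹' A =ᵐ[μ] A) → EventuallyConst A (ae μ)) {w : X → ℝ} (hwm : Measurable w)
    (hw : ∀ r, (fun x => w (u r x)) =ᵐ[μ] w) : ∃ c, w =ᵐ[μ] Function.const X c := by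
  refine exists_eventuallyEq_const_of_forall_separating MeasurableSet fun B hB => ?_
  refine eventuallyConst_set.1 (herg (w ⁻¹' B) (hwm hB) fun r => ?_)
  filter_upwards [hw r] with x hx
  change (w (u r x) ∈ B) = (w x ∈ B)
  rw [hx]

end IsMeasurePreservingFlow

/-- An ergodic renormalized flow is mixing. -/
theorem IsRenormalizedFlow.tendsto_integral_mul {X : Type*} [MeasurableSpace X] {μ : Measure X}
    [IsProbabilityMeasure μ] {u D : ℝ → X → X} {lam : ℝ} (hu : IsRenormalizedFlow u D lam μ)
    (herg : ∀ A : Set X, MeasurableSet A →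
      (∀ r, u r ⁻¹' A =ᵐ[μ] A) → EventuallyConst A (ae μ))
    {f h : X → ℝ} (hf : IsBddMeasurable f) (hh : IsBddMeasurable h) :
    Tendsto (fun s => ∫ x, f (u s x) * h x ∂μ) (cocompact ℝ)
      (𝓝 ((∫ x, f x ∂μ) * ∫ x, h x ∂μ)) := by
  set U : ℝ → Lp ℝ 2 μ →ₗᵢ[ℝ] Lp ℝ 2 μ := fun s =>
    Lp.compMeasurePreservingₗᵢ ℝ (u s) (hu.flow.measurePreserving s) with hU
  have hcomp : ∀ {g : X → ℝ}, IsBddMeasurable g → ∀ r, IsBddMeasurable fun x => g (u r x) :=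
    fun hg r => hg.comp (hu.flow.measurePreserving r).measurable
  have hinner : ∀ {g : X → ℝ} (hg : IsBddMeasurable g) (s : ℝ),
      inner ℝ (U s ((hg.memLp 2 μ).toLp g)) ((hh.memLp 2 μ).toLp h)
        = ∫ x, g (u s x) * h x ∂μ := fun {g} hg s => by
    rw [L2.inner_def]
    refine integral_congr_ae ?_
    filter_upwards [(hh.memLp 2 μ).coeFn_toLp, Lp.coeFn_compMeasurePreserving
      ((hg.memLp 2 μ).toLp g) (hu.flow.measurePreserving s),
      (hu.flow.measurePreserving s).quasiMeasurePreserving.ae (hg.memLp 2 μ).coeFn_toLp]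
      with x h1 h2 h3
    have h2' : (U s ((hg.memLp 2 μ).toLp g) : X → ℝ) x = g (u s x) := h2.trans h3
    rw [h1, h2']
    simp [mul_comm]
  have hf₀ : IsBddMeasurable fun x => f x - ∫ y, f y ∂μ := hf.sub (.const _)
  have key : Tendsto (fun s => ∫ x, (f (u s x) - ∫ y, f y ∂μ) * h x ∂μ) (cocompact ℝ) (𝓝 0) := by
    simp only [← hinner hf₀]
    refine tendsto_inner_isometry_of_orthogonal U _
      (V := {v | ∃ (g : X → ℝ) (hg : IsBddMeasurable g) (r : ℝ),
        v = ((hg.sub (hcomp hg r)).memLp 2 μ).toLp _}) ?_ ?_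
    · rintro _ ⟨g, hg, r, rfl⟩
      simp only [hinner (hg.sub (hcomp hg r))]
      obtain ⟨C, hC⟩ := hg.2
      obtain ⟨C', hC'⟩ := hh.2
      -- Times `(s, 0)` with scale `S = s` have ratios `(1, 0)`, so only `g` is shifted.
      have := hu.tendsto_integral_prod_shift_sub (l := cocompact ℝ) (Finset.univ : Finset (Fin 2))
        (f := ![g, h]) (C := max C C')
        (fun i => by fin_cases i <;> simp [hg.1, hh.1])
        (fun i x => by
          fin_cases i
          · exact (hC x).trans (le_max_left _ _)
          · exact (hC' x).trans (le_max_right _ _))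
        (S := id) tendsto_id (d := ![id, fun _ => 0]) (ρ := ![1, 0])
        (fun i _ => by
          fin_cases i
          · refine tendsto_const_nhds.congr' ?_
            filter_upwards [(Set.finite_singleton (0 : ℝ)).isCompact.compl_mem_cocompact]
              with s hs
            have hs' : s ≠ 0 := hs
            simp [hs']
          · simp) r
      simp only [Fin.prod_univ_two, Matrix.cons_val_zero, Matrix.cons_val_one, mul_one, mul_zero,
        hu.flow.zero, id] at this
      rw [← neg_zero]
      refine this.neg.congr fun s => ?_
      rw [neg_sub, ← integral_sub (((hcomp hg s).mul hh).integrable μ)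
        (((hcomp (hcomp hg r) s).mul hh).integrable μ)]
      simp only [sub_mul]
    -- Such a `w` is invariant, hence a constant `c`, and `f` minus its mean is orthogonal to
    -- constants.
    · intro w hw
      have hwL : MemLp w 2 μ := Lp.memLp w
      have hwi : Integrable w μ := hwL.integrable (by norm_num)
      obtain ⟨c, hc⟩ := IsMeasurePreservingFlow.exists_ae_eq_const herg
        (Lp.stronglyMeasurable w).measurable
        (hu.flow.ae_eq_comp_of_integral_mul_sub_eq_zero (Lp.stronglyMeasurable w) hwi
          fun g hg r => by
            rw [← hw _ ⟨g, hg, r, rfl⟩, L2.inner_def]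
            refine integral_congr_ae ?_
            filter_upwards [((hg.sub (hcomp hg r)).memLp 2 μ).coeFn_toLp] with x hx
            rw [hx]
            simp [mul_comm])
      have : inner ℝ w ((hf₀.memLp 2 μ).toLp _) = ∫ x, c * (f x - ∫ y, f y ∂μ) ∂μ := by
        rw [L2.inner_def]
        refine integral_congr_ae ?_
        filter_upwards [(hf₀.memLp 2 μ).coeFn_toLp, hc] with x hx hx'
        rw [hx, hx']
        simp [mul_comm]
      rw [this, integral_const_mul, integral_sub (hf.integrable μ) (integrable_const _)]
      simp
  have h2 := key.add_const ((∫ x, f x ∂μ) * ∫ x, h x ∂μ)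
  rw [zero_add] at h2
  refine h2.congr fun s => ?_
  simp only [sub_mul]
  rw [integral_sub (((hcomp hf s).mul hh).integrable μ) ((hh.integrable μ).const_mul _),
    integral_const_mul]
  ring

/-! ### Mixing of all orders for bounded functions -/

theorem IsBddMeasurable.inner_toLp {X : Type*} [MeasurableSpace X] {μ : Measure X}
    [IsFiniteMeasure μ] {f g : X → ℝ} (hf : IsBddMeasurable f) (hg : IsBddMeasurable g) :
    inner ℝ ((hf.memLp 2 μ).toLp f) ((hg.memLp 2 μ).toLp g) = ∫ x, f x * g x ∂μ := by
  rw [L2.inner_def]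
  refine integral_congr_ae ?_
  filter_upwards [(hf.memLp 2 μ).coeFn_toLp, (hg.memLp 2 μ).coeFn_toLp] with x h1 h2
  rw [h1, h2]
  simp [mul_comm]

theorem IsBddMeasurable.integral_sub_const_mul_sub_const {X : Type*} [MeasurableSpace X]
    {μ : Measure X} [IsProbabilityMeasure μ] {f g : X → ℝ} (hf : IsBddMeasurable f)
    (hg : IsBddMeasurable g) (c : ℝ) :
    ∫ x, (f x - c) * (g x - c) ∂μ
      = ∫ x, f x * g x ∂μ - c * ∫ x, f x ∂μ - c * ∫ x, g x ∂μ + c ^ 2 := by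
  have hfi := hf.integrable μ
  have hgi := hg.integrable μ
  have hfgi := (hf.mul hg).integrable μ
  have h1 : Integrable (fun x => f x * g x - c * f x) μ := hfgi.sub (hfi.const_mul c)
  have h2 : Integrable (fun x => f x * g x - c * f x - c * g x) μ := h1.sub (hgi.const_mul c)
  have e : ∀ x, (f x - c) * (g x - c) = f x * g x - c * f x - c * g x + c ^ 2 := fun x => by ring
  simp only [e]
  rw [integral_add h2 (integrable_const _), integral_sub h1 (hgi.const_mul c),
    integral_sub hfgi (hfi.const_mul c), integral_const_mul, integral_const_mul]
  simp

/-- Among finitely many real functions diverging from each other, one along an ultrafilter has the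
largest distance to a given one; after normalization by this distance all of them converge. -/
theorem exists_tendsto_div_of_tendsto_cocompact {α ι : Type*} (l : Ultrafilter α) {I : Finset ι}
    (hI : I.Nontrivial) {d : ι → α → ℝ}
    (hd : ∀ i ∈ I, ∀ j ∈ I, i ≠ j → Tendsto (fun n => d i n - d j n) l (cocompact ℝ)) :
    ∃ b ∈ I, ∃ j ∈ I, ∃ ρ : ι → ℝ, ρ b = 0 ∧ ρ j ≠ 0 ∧
      Tendsto (fun n => d j n - d b n) l (cocompact ℝ) ∧
      ∀ i ∈ I, Tendsto (fun n => (d i n - d b n) / (d j n - d b n)) l (𝓝 (ρ i)) := by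
  classical
  obtain ⟨b, hb, j₀, hj₀, hbj₀⟩ := hI
  have hmax : ∀ n, ∃ j ∈ (I.erase b : Set ι), ∀ i ∈ I.erase b,
      |d i n - d b n| ≤ |d j n - d b n| := fun n =>
    (I.erase b).exists_max_image (fun i => |d i n - d b n|)
      ⟨j₀, Finset.mem_erase.2 ⟨hbj₀.symm, hj₀⟩⟩
  -- The farthest index depends on `n`, but with finitely many candidates the ultrafilter selects
  -- one.
  obtain ⟨j, hj, hjmax⟩ := (Ultrafilter.eventually_exists_mem_iff (I.erase b).finite_toSet).1
    (Filter.Eventually.of_forall (f := (l : Filter α)) hmax)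
  obtain ⟨hjb, hjI⟩ := Finset.mem_erase.1 hj
  have hS := hd j hjI b hb hjb
  have hS0 : ∀ᶠ n in (l : Filter α), d j n - d b n ≠ 0 :=
    hS.eventually ((Set.finite_singleton (0 : ℝ)).isCompact.compl_mem_cocompact)
  -- By maximality of `j` the ratios lie in the compact interval `[-1, 1]`.
  have hex : ∀ i ∈ I, ∃ r, Tendsto (fun n => (d i n - d b n) / (d j n - d b n)) l (𝓝 r) := by
    intro i hi
    obtain ⟨r, -, hr⟩ := (isCompact_Icc (a := (-1 : ℝ)) (b := 1)).ultrafilter_le_nhds'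
      (l.map fun n => (d i n - d b n) / (d j n - d b n)) (by
        rw [Ultrafilter.mem_map]
        filter_upwards [hjmax, hS0] with n hn hn0
        rw [Set.mem_preimage, Set.mem_Icc, ← abs_le, abs_div]
        refine div_le_one_of_le₀ ?_ (abs_nonneg _)
        by_cases hib : i = b
        · simp [hib]
        · exact hn i (Finset.mem_erase.2 ⟨hib, hi⟩))
    exact ⟨r, hr⟩
  choose! ρ hρ using hex
  refine ⟨b, hb, j, hjI, ρ, ?_, ?_, hS, hρ⟩
  · refine tendsto_nhds_unique (hρ b hb) ?_
    simp
  · have : ρ j = 1 := by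
      refine tendsto_nhds_unique (hρ j hjI) (tendsto_const_nhds.congr' ?_)
      filter_upwards [hS0] with n hn
      exact (div_self hn).symm
    rw [this]
    exact one_ne_zero

namespace IsRenormalizedFlow

variable {X : Type*} [MeasurableSpace X] {μ : Measure X} [IsProbabilityMeasure μ]
  {u D : ℝ → X → X} {lam : ℝ}

/-- Mixing implies mixing of all orders along ultrafilters for renormalized flows, on uniformly
bounded functions. -/
theorem tendsto_integral_prod_ultrafilter (hu : IsRenormalizedFlow u D lam μ)
    (hmix : ∀ f h : X → ℝ, IsBddMeasurable f → IsBddMeasurable h →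
      Tendsto (fun s => ∫ x, f (u s x) * h x ∂μ) (cocompact ℝ)
        (𝓝 ((∫ x, f x ∂μ) * ∫ x, h x ∂μ)))
    {α ι : Type*} (l : Ultrafilter α) {d : ι → α → ℝ} (I : Finset ι)
    (hd : ∀ i ∈ I, ∀ j ∈ I, i ≠ j → Tendsto (fun n => d i n - d j n) l (cocompact ℝ))
    {f : ι → X → ℝ} {C : ℝ} (hf : ∀ i, Measurable (f i)) (hC : ∀ i x, |f i x| ≤ C) :
    Tendsto (fun n => ∫ x, ∏ i ∈ I, f i (u (d i n) x) ∂μ) l (𝓝 (∏ i ∈ I, ∫ x, f i x ∂μ)) := by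
  classical
  induction I using Finset.strongInduction generalizing f C with
  | H I ih =>
  have hum : ∀ r, Measurable (u r) := fun r => (hu.flow.measurePreserving r).measurable
  by_cases hI : I.Nontrivial
  swap
  · rcases I.eq_empty_or_nonempty with rfl | ⟨i, hi⟩
    · simp
    · have hIi : I = {i} := Finset.eq_singleton_iff_unique_mem.2
        ⟨hi, fun j hj => by_contra fun h => hI ⟨j, hj, i, hi, h⟩⟩
      simp only [hIi, Finset.prod_singleton,
        (hu.flow.measurePreserving _).integral_comp_of_measurable (hf i)]
      exact tendsto_const_nhds
  obtain ⟨b, hb, j, hj, ρ, hρb, hρj, hS, hρ⟩ := exists_tendsto_div_of_tendsto_cocompact l hI hd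
  -- `A` omits `j` and `B` omits `b`, so the induction hypothesis applies to both.
  set A := I.filter fun i => ρ i = 0 with hA
  set B := I.filter fun i => ¬ ρ i = 0 with hB
  have hAI : A ⊂ I := Finset.filter_ssubset.2 ⟨j, hj, hρj⟩
  have hBI : B ⊂ I := Finset.filter_ssubset.2 ⟨b, hb, not_not.2 hρb⟩
  have hsplit : ∀ g : ι → ℝ, (∏ i ∈ A, g i) * ∏ i ∈ B, g i = ∏ i ∈ I, g i := fun g =>
    Finset.prod_filter_mul_prod_filter_not I (fun i => ρ i = 0) g
  have ihA := ih A hAI (fun i hi j hj => hd i (hAI.1 hi) j (hAI.1 hj)) hf hC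
  have ihB : ∀ {g : ι → X → ℝ} {C : ℝ}, (∀ i, Measurable (g i)) → (∀ i x, |g i x| ≤ C) →
      Tendsto (fun n => ∫ x, ∏ i ∈ B, g i (u (d i n) x) ∂μ) l (𝓝 (∏ i ∈ B, ∫ x, g i x ∂μ)) :=
    ih B hBI (fun i hi j hj => hd i (hBI.1 hi) j (hBI.1 hj))
  set c : ℝ := ∏ i ∈ B, ∫ x, f i x ∂μ with hc
  have hbf : ∀ i, IsBddMeasurable (f i) := fun i => ⟨hf i, C, hC i⟩
  have hbu : ∀ i (r : ℝ) (n : α), IsBddMeasurable fun x => f i (u (r * ρ i) (u (d i n) x)) :=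
    fun i r n => ((hbf i).comp (hum _)).comp (hum _)
  have hbA : ∀ n, IsBddMeasurable fun x => ∏ i ∈ A, f i (u (d i n) x) := fun n =>
    .prod A fun i => (hbf i).comp (hum _)
  have hbP : ∀ (m : ℕ) n, IsBddMeasurable fun x => ∏ i ∈ B, f i (u (m * ρ i) (u (d i n) x)) :=
    fun m n => .prod B fun i => hbu i m n
  have hbB : ∀ (m : ℕ) n, IsBddMeasurable
      fun x => ∏ i ∈ B, f i (u (m * ρ i) (u (d i n) x)) - c := fun m n => (hbP m n).sub (.const c)
  have hAB : ∀ (m : ℕ) n, ∫ x, (∏ i ∈ A, f i (u (d i n) x)) *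
      (∏ i ∈ B, f i (u (m * ρ i) (u (d i n) x)) - c) ∂μ
      = ∫ x, ∏ i ∈ I, f i (u (m * ρ i) (u (d i n) x)) ∂μ
        - c * ∫ x, ∏ i ∈ A, f i (u (d i n) x) ∂μ := fun m n => by
    rw [← integral_const_mul, ← integral_sub ((IsBddMeasurable.prod I fun i => hbu i m n).integrable μ)
      (((hbA n).integrable μ).const_mul c)]
    refine integral_congr_ae (.of_forall fun x => ?_)
    have : ∏ i ∈ A, f i (u (m * ρ i) (u (d i n) x)) = ∏ i ∈ A, f i (u (d i n) x) :=
      Finset.prod_congr rfl fun i hi => by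
        rw [(Finset.mem_filter.1 hi).2, mul_zero, hu.flow.zero]
    simp only [← hsplit, this]
    ring
  have hshift : ∀ m : ℕ, Tendsto (fun n => ∫ x, ∏ i ∈ I, f i (u (m * ρ i) (u (d i n) x)) ∂μ
      - ∫ x, ∏ i ∈ I, f i (u (d i n) x) ∂μ) l (𝓝 0) := fun m => by
    refine (hu.tendsto_integral_prod_shift_sub I hf hC hS hρ m).congr fun n => ?_
    -- Only the times relative to `d b` have ratios converging to `ρ`; subtracting `d b n` from all
    -- times does not change the integral.
    have e : ∀ g : ι → X → ℝ, (∀ i, Measurable (g i)) →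
        ∫ x, ∏ i ∈ I, g i (u (d i n - d b n) x) ∂μ = ∫ x, ∏ i ∈ I, g i (u (d i n) x) ∂μ :=
      fun g hg => by
        rw [← (hu.flow.measurePreserving (d b n)).integral_comp_of_measurable
          (f := fun x => ∏ i ∈ I, g i (u (d i n - d b n) x))
          (Finset.measurable_fun_prod _ fun i _ => (hg i).comp (hum _))]
        simp only [← hu.flow.add, sub_add_cancel]
    rw [e f hf, e (fun i x => f i (u (m * ρ i) x)) fun i => (hf i).comp (hum _)]
  -- The limit of `⟪v m, v m'⟫` will be `ψ (m - m')`. As `|t| → ∞` each factor tends to `(∫ f i) ^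
  -- 2`, by mixing and `ρ i ≠ 0`, and these limits multiply to `c ^ 2`.
  set ψ : ℝ → ℝ := fun t => ∏ i ∈ B, ∫ x, f i (u (t * ρ i) x) * f i x ∂μ - c ^ 2 with hψ
  have hψ0 : Tendsto ψ (cocompact ℝ) (𝓝 0) := by
    have h1 : Tendsto (fun t => ∏ i ∈ B, ∫ x, f i (u (t * ρ i) x) * f i x ∂μ) (cocompact ℝ)
        (𝓝 (∏ i ∈ B, ((∫ x, f i x ∂μ) * ∫ x, f i x ∂μ))) := by
      refine tendsto_finsetProd _ fun i hi => ?_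
      exact (hmix _ _ (hbf i) (hbf i)).comp
        (Homeomorph.mulRight₀ (ρ i) (Finset.mem_filter.1 hi).2).isClosedEmbedding.tendsto_cocompact
    have h2 := h1.sub_const (c ^ 2)
    rwa [Finset.prod_mul_distrib, ← hc, ← sq, sub_self] at h2
  have hin : ∀ (m : ℕ) n, inner ℝ (((hbA n).memLp 2 μ).toLp _) (((hbB m n).memLp 2 μ).toLp _)
      = ∫ x, ∏ i ∈ I, f i (u (m * ρ i) (u (d i n) x)) ∂μ
        - c * ∫ x, ∏ i ∈ A, f i (u (d i n) x) ∂μ :=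
    fun m n => ((hbA n).inner_toLp (hbB m n)).trans (hAB m n)
  have h0 : ∀ n, ∫ x, ∏ i ∈ I, f i (u ((0 : ℕ) * ρ i) (u (d i n) x)) ∂μ
      = ∫ x, ∏ i ∈ I, f i (u (d i n) x) ∂μ := by
    simp [hu.flow.zero]
  have key := tendsto_inner_zero_of_correlations (l := (l : Filter α)) (C := |C| ^ A.card)
    (h := fun n => ((hbA n).memLp 2 μ).toLp _)
    (v := fun m n => ((hbB m n).memLp 2 μ).toLp _) (fun n => by
      refine (Lp.norm_le_of_ae_bound (C := |C| ^ A.card) (by positivity) ?_).trans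
        (by simp [measureUnivNNReal])
      filter_upwards [((hbA n).memLp 2 μ).coeFn_toLp] with x hx
      rw [hx, Real.norm_eq_abs, Finset.abs_prod]
      exact (Finset.prod_le_prod (fun _ _ => abs_nonneg _) fun i _ =>
        (hC i _).trans (le_abs_self C)).trans_eq (by simp))
    (fun m => by
      simp only [hin, h0, sub_sub_sub_cancel_right]
      exact hshift m)
    (a := fun m m' => ψ (m - m')) (fun m m' => by
      simp only [(hbB _ _).inner_toLp (hbB _ _)]
      -- The product of two shifted `B`-products is again a product over `B`, of the bounded
      -- functions `g i`; this is why the induction is uniform in the functions and their bound.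
      have t1 := ihB (g := fun i x => f i (u (m * ρ i) x) * f i (u (m' * ρ i) x)) (C := C * C)
        (fun i => ((hf i).comp (hum _)).mul ((hf i).comp (hum _)))
        (fun i x => by
          rw [abs_mul]
          exact mul_le_mul (hC i _) (hC i _) (abs_nonneg _) ((abs_nonneg _).trans (hC i x)))
      have t2 : ∀ m : ℕ, Tendsto
          (fun n => ∫ x, ∏ i ∈ B, f i (u (m * ρ i) (u (d i n) x)) ∂μ) l (𝓝 c) := fun m => by
        have := ihB (g := fun i x => f i (u (m * ρ i) x)) (fun i => (hf i).comp (hum _))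
          (fun i x => hC i _)
        simpa only [(hu.flow.measurePreserving _).integral_comp_of_measurable (hf _)] using this
      have t3 := ((t1.sub ((t2 m).const_mul c)).sub ((t2 m').const_mul c)).add_const (c ^ 2)
      have e : ∏ i ∈ B, ∫ x, f i (u (m * ρ i) x) * f i (u (m' * ρ i) x) ∂μ - c * c - c * c + c ^ 2
          = ψ (m - m') := by
        have : ∀ i, ∫ x, f i (u (m * ρ i) x) * f i (u (m' * ρ i) x) ∂μ
            = ∫ x, f i (u ((m - m') * ρ i) x) * f i x ∂μ := fun i => by
          rw [← (hu.flow.measurePreserving (m' * ρ i)).integral_comp_of_measurable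
            (f := fun x => f i (u ((m - m') * ρ i) x) * f i x)
            (((hf i).comp (hum _)).mul (hf i))]
          simp only [← hu.flow.add, ← add_mul, sub_add_cancel]
        simp only [hψ, this]
        ring
      rw [e] at t3
      refine t3.congr fun n => ?_
      rw [(hbP m n).integral_sub_const_mul_sub_const (hbP m' n) c]
      simp only [Finset.prod_mul_distrib])
    (M := ψ 0) (fun m => by simp) (fun ε hε => by
      have h1 := hψ0.eventually (ge_mem_nhds hε)
      rw [← Metric.cobounded_eq_cocompact] at h1
      obtain ⟨r, -, hr⟩ := Filter.hasBasis_cobounded_norm.eventually_iff.1 h1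
      obtain ⟨R, hR⟩ := exists_nat_ge r
      -- Distinct multiples of `R` differ by at least `R ≥ r`.
      refine ⟨R, fun m m' hmm => hr ?_⟩
      have h2 : (1 : ℝ) ≤ |(m : ℝ) - m'| := by
        have : (1 : ℤ) ≤ |(m : ℤ) - m'| := Int.one_le_abs (sub_ne_zero.2 (by exact_mod_cast hmm))
        exact_mod_cast this
      rw [Set.mem_ofPred_eq, Nat.cast_mul, Nat.cast_mul, ← mul_sub, norm_mul, Real.norm_natCast,
        Real.norm_eq_abs]
      nlinarith [(Nat.cast_nonneg R : (0 : ℝ) ≤ R)])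
  simp only [hin, h0] at key
  have h1 := key.add (ihA.const_mul c)
  rw [zero_add, mul_comm c, hc, hsplit] at h1
  exact h1.congr fun n => by ring

end IsRenormalizedFlow

/-! ### Passage to `L^k` and to arbitrary filters -/

section Holder

variable {X ι : Type*} [MeasurableSpace X] {μ : Measure X} {I : Finset ι} {k : ℕ} {f : ι → X → ℝ}

theorem MeasureTheory.integrable_prod_of_memLp_card (hk : k ≠ 0) (hI : I.card = k)
    (hf : ∀ i ∈ I, MemLp (f i) k μ) : Integrable (fun x => ∏ i ∈ I, f i x) μ := by
  have h := MemLp.prod' hf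
  rw [Finset.sum_const, hI, nsmul_eq_mul, ENNReal.mul_inv_cancel (by simpa using hk) (by simp),
    inv_one] at h
  exact memLp_one_iff_integrable.1 h

/-- Hölder's inequality for `k` functions in `L^k`. -/
theorem MeasureTheory.abs_integral_prod_le_prod_eLpNorm (hk : k ≠ 0) (hI : I.card = k)
    (hf : ∀ i ∈ I, MemLp (f i) k μ) :
    |∫ x, ∏ i ∈ I, f i x ∂μ| ≤ ∏ i ∈ I, (eLpNorm (f i) k μ).toReal := by
  have hk' : (k : ℝ) ≠ 0 := by exact_mod_cast hk
  have h1 : ∫⁻ x, ‖∏ i ∈ I, f i x‖ₑ ∂μ ≤ ∏ i ∈ I, eLpNorm (f i) k μ := by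
    have := ENNReal.lintegral_prod_norm_pow_le (μ := μ) I
      (f := fun i x => ‖f i x‖ₑ ^ (k : ℝ)) (fun i hi => (hf i hi).1.enorm.pow_const _)
      (p := fun _ => (k : ℝ)⁻¹) (by simp [hI, hk']) (fun _ _ => by positivity)
    simp only [← ENNReal.rpow_mul, mul_inv_cancel₀ hk', ENNReal.rpow_one] at this
    refine (lintegral_congr fun x => ?_).trans_le (this.trans_eq ?_)
    · simp only [enorm_eq_nnnorm, nnnorm_prod, ENNReal.ofNNReal_finsetProd]
    · refine Finset.prod_congr rfl fun i _ => ?_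
      rw [eLpNorm_eq_lintegral_rpow_enorm_toReal (by simpa using hk) (by simp)]
      simp
  rw [← ENNReal.toReal_prod, ← Real.norm_eq_abs]
  refine (norm_integral_le_lintegral_norm _).trans ?_
  refine ENNReal.toReal_mono (ENNReal.prod_ne_top fun i hi => (hf i hi).eLpNorm_ne_top) ?_
  simpa only [ofReal_norm] using h1

theorem MeasureTheory.abs_integral_le_eLpNorm [IsProbabilityMeasure μ] (hk : k ≠ 0) {g : X → ℝ}
    (hg : MemLp g k μ) : |∫ x, g x ∂μ| ≤ (eLpNorm g k μ).toReal := by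
  rw [← Real.norm_eq_abs]
  refine (norm_integral_le_lintegral_norm _).trans ?_
  refine ENNReal.toReal_mono hg.eLpNorm_ne_top ?_
  simp only [ofReal_norm, ← eLpNorm_one_eq_lintegral_enorm]
  exact eLpNorm_le_eLpNorm_of_exponent_le (by exact_mod_cast Nat.one_le_iff_ne_zero.2 hk) hg.1

end Holder

/-- Convergence of multiple correlations of `k` functions extends from bounded functions to
functions in `L^k`. -/
theorem tendsto_integral_prod_comp_of_bddMeasurable {X α ι : Type*} [MeasurableSpace X]
    {μ : Measure X} [IsProbabilityMeasure μ] {l : Filter α} {I : Finset ι} {k : ℕ} (hk : k ≠ 0)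
    (hI : I.card = k) {T : ι → α → X → X} (hT : ∀ i n, MeasurePreserving (T i n) μ μ)
    (hbdd : ∀ g : ι → X → ℝ, (∀ i ∈ I, IsBddMeasurable (g i)) →
      Tendsto (fun n => ∫ x, ∏ i ∈ I, g i (T i n x) ∂μ) l (𝓝 (∏ i ∈ I, ∫ x, g i x ∂μ)))
    {f : ι → X → ℝ} (hf : ∀ i ∈ I, MemLp (f i) k μ) :
    Tendsto (fun n => ∫ x, ∏ i ∈ I, f i (T i n x) ∂μ) l (𝓝 (∏ i ∈ I, ∫ x, f i x ∂μ)) := by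
  classical
  have hk1 : (1 : ENNReal) ≤ k := by exact_mod_cast Nat.one_le_iff_ne_zero.2 hk
  -- Only indices in `J` may carry unbounded functions; the induction makes them bounded one by one.
  suffices H : ∀ J : Finset ι, ∀ f : ι → X → ℝ, (∀ i ∈ I, MemLp (f i) k μ) →
      (∀ i ∈ I, i ∉ J → IsBddMeasurable (f i)) →
      Tendsto (fun n => ∫ x, ∏ i ∈ I, f i (T i n x) ∂μ) l (𝓝 (∏ i ∈ I, ∫ x, f i x ∂μ)) from
    H I f hf fun i hi hi' => absurd hi hi'
  intro J
  induction J using Finset.induction_on with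
  | empty => exact fun f _ hfb => hbdd f fun i hi => hfb i hi (Finset.notMem_empty i)
  | insert j J hj ih =>
    intro f hf hfb
    by_cases hjI : j ∈ I
    swap
    · exact ih f hf fun i hi hiJ => hfb i hi fun h => (Finset.mem_insert.1 h).elim
        (fun e => hjI (e ▸ hi)) hiJ
    rw [Metric.tendsto_nhds]
    intro ε hε
    set K : ℝ := ∏ i ∈ I.erase j, (eLpNorm (f i) k μ).toReal with hK
    have hK0 : 0 ≤ K := Finset.prod_nonneg fun _ _ => ENNReal.toReal_nonneg
    -- The `+ 1` covers `K = 0`.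
    set η : ℝ := ε / (3 * (K + 1)) with hη
    have hη0 : 0 < η := by positivity
    have hηK : η * K ≤ ε / 3 := by
      rw [hη, div_mul_eq_mul_div, div_le_div_iff₀ (by positivity) (by norm_num)]
      nlinarith
    obtain ⟨g, hg, hgL⟩ := (hf j hjI).exists_simpleFunc_eLpNorm_sub_lt (ENNReal.natCast_ne_top k)
      (ENNReal.ofReal_pos.2 hη0).ne'
    have hgb : IsBddMeasurable ⇑g := ⟨g.measurable, g.exists_forall_norm_le⟩
    have hjg : MemLp (f j - ⇑g) k μ := (hf j hjI).sub hgL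
    have hgη : (eLpNorm (f j - ⇑g) k μ).toReal ≤ η :=
      ENNReal.toReal_le_of_le_ofReal hη0.le hg.le
    -- Correlations are linear in slot `j`, so `f j = g + (f j - g)` splits them. The part with `f j
    -- - g` is at most `η * K ≤ ε / 3` by Hölder, uniformly in `n`, and so is the product of its
    -- integrals; `f'` falls under the induction hypothesis.
    set f' : ι → X → ℝ := fun i => if i = j then ⇑g else f i with hf'
    set e : ι → X → ℝ := fun i => if i = j then f j - ⇑g else f i with he
    have hf'L : ∀ i ∈ I, MemLp (f' i) k μ := fun i hi => by
      by_cases hij : i = j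
      · simpa [hf', hij] using hgL
      · simpa [hf', hij] using hf i hi
    have heL : ∀ i ∈ I, MemLp (e i) k μ := fun i hi => by
      by_cases hij : i = j
      · simpa [he, hij] using hjg
      · simpa [he, hij] using hf i hi
    have hf'b : ∀ i ∈ I, i ∉ J → IsBddMeasurable (f' i) := fun i hi hiJ => by
      by_cases hij : i = j
      · simpa [hf', hij] using hgb
      · simpa [hf', hij] using hfb i hi (by simp [hij, hiJ])
    have hprod : ∀ y : ι → X, ∏ i ∈ I, f i (y i) = ∏ i ∈ I, f' i (y i) + ∏ i ∈ I, e i (y i) := by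
      intro y
      have h1 : ∏ i ∈ I.erase j, f' i (y i) = ∏ i ∈ I.erase j, f i (y i) :=
        Finset.prod_congr rfl fun i hi => by simp [hf', Finset.ne_of_mem_erase hi]
      have h2 : ∏ i ∈ I.erase j, e i (y i) = ∏ i ∈ I.erase j, f i (y i) :=
        Finset.prod_congr rfl fun i hi => by simp [he, Finset.ne_of_mem_erase hi]
      rw [← Finset.mul_prod_erase I _ hjI, ← Finset.mul_prod_erase I (fun i => f' i (y i)) hjI,
        ← Finset.mul_prod_erase I (fun i => e i (y i)) hjI, h1, h2]
      simp [hf', he]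
      ring
    have hprodI : ∏ i ∈ I, ∫ x, f i x ∂μ = ∏ i ∈ I, ∫ x, f' i x ∂μ + ∏ i ∈ I, ∫ x, e i x ∂μ := by
      have h1 : ∏ i ∈ I.erase j, ∫ x, f' i x ∂μ = ∏ i ∈ I.erase j, ∫ x, f i x ∂μ :=
        Finset.prod_congr rfl fun i hi => by simp [hf', Finset.ne_of_mem_erase hi]
      have h2 : ∏ i ∈ I.erase j, ∫ x, e i x ∂μ = ∏ i ∈ I.erase j, ∫ x, f i x ∂μ :=
        Finset.prod_congr rfl fun i hi => by simp [he, Finset.ne_of_mem_erase hi]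
      have h3 : ∫ x, e j x ∂μ = ∫ x, f j x ∂μ - ∫ x, f' j x ∂μ := by
        simp only [he, hf', if_true]
        exact integral_sub ((hf j hjI).integrable hk1) (hgL.integrable hk1)
      rw [← Finset.mul_prod_erase I _ hjI, ← Finset.mul_prod_erase I (fun i => ∫ x, f' i x ∂μ) hjI,
        ← Finset.mul_prod_erase I (fun i => ∫ x, e i x ∂μ) hjI, h1, h2, h3]
      ring
    have heK : ∏ i ∈ I, (eLpNorm (e i) k μ).toReal ≤ ε / 3 := by
      have h2 : ∏ i ∈ I.erase j, (eLpNorm (e i) k μ).toReal = K :=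
        Finset.prod_congr rfl fun i hi => by simp [he, Finset.ne_of_mem_erase hi]
      rw [← Finset.mul_prod_erase I _ hjI, h2]
      refine le_trans (mul_le_mul_of_nonneg_right ?_ hK0) hηK
      simpa [he] using hgη
    have hcomp : ∀ {F : ι → X → ℝ}, (∀ i ∈ I, MemLp (F i) k μ) → ∀ n, ∀ i ∈ I,
        MemLp (fun x => F i (T i n x)) k μ :=
      fun hF n i hi => (hF i hi).comp_measurePreserving (hT i n)
    filter_upwards [Metric.tendsto_nhds.1 (ih f' hf'L hf'b) (ε / 3) (by positivity)] with n hn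
    have b1 : |∫ x, ∏ i ∈ I, e i (T i n x) ∂μ| ≤ ε / 3 := by
      refine (abs_integral_prod_le_prod_eLpNorm hk hI (hcomp heL n)).trans (le_trans ?_ heK)
      refine (Finset.prod_congr rfl fun i hi => ?_).le
      rw [← eLpNorm_comp_measurePreserving (heL i hi).1 (hT i n)]
      rfl
    have b2 : |∏ i ∈ I, ∫ x, e i x ∂μ| ≤ ε / 3 := by
      rw [Finset.abs_prod]
      exact (Finset.prod_le_prod (fun _ _ => abs_nonneg _) fun i hi =>
        abs_integral_le_eLpNorm hk (heL i hi)).trans heK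
    simp only [hprod]
    rw [integral_add (integrable_prod_of_memLp_card hk hI (hcomp hf'L n))
      (integrable_prod_of_memLp_card hk hI (hcomp heL n)), hprodI]
    rw [Real.dist_eq, abs_lt] at hn ⊢
    rw [abs_le] at b1 b2
    constructor <;> linarith [hn.1, hn.2, b1.1, b1.2, b2.1, b2.2]

/-- Mixing implies mixing of all orders for renormalized flows, on bounded functions. -/
theorem IsRenormalizedFlow.tendsto_integral_prod {X : Type*} [MeasurableSpace X] {μ : Measure X}
    [IsProbabilityMeasure μ] {u D : ℝ → X → X} {lam : ℝ} (hu : IsRenormalizedFlow u D lam μ)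
    (hmix : ∀ f h : X → ℝ, IsBddMeasurable f → IsBddMeasurable h →
      Tendsto (fun s => ∫ x, f (u s x) * h x ∂μ) (cocompact ℝ)
        (𝓝 ((∫ x, f x ∂μ) * ∫ x, h x ∂μ)))
    {α ι : Type*} {l : Filter α} {d : ι → α → ℝ} (I : Finset ι)
    (hd : ∀ i ∈ I, ∀ j ∈ I, i ≠ j → Tendsto (fun n => d i n - d j n) l (cocompact ℝ))
    {f : ι → X → ℝ} (hf : ∀ i ∈ I, IsBddMeasurable (f i)) :
    Tendsto (fun n => ∫ x, ∏ i ∈ I, f i (u (d i n) x) ∂μ) l (𝓝 (∏ i ∈ I, ∫ x, f i x ∂μ)) := by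
  classical
  rw [tendsto_iff_ultrafilter]
  intro l' hl'
  choose! c hc using fun i hi => (hf i hi).bdd
  -- Extending `f` by zero outside `I` gives one bound for all indices.
  have key := hu.tendsto_integral_prod_ultrafilter hmix l' I
    (fun i hi j hj hij => (hd i hi j hj hij).mono_left hl')
    (f := fun i => if i ∈ I then f i else fun _ => 0) (C := ∑ i ∈ I, |c i|)
    (fun i => by
      by_cases hi : i ∈ I
      · simpa [hi] using (hf i hi).measurable
      · simp [hi])
    (fun i x => by
      by_cases hi : i ∈ I
      · simp only [hi, if_true]
        exact (hc i hi x).trans ((le_abs_self _).trans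
          (Finset.single_le_sum (f := fun i => |c i|) (fun _ _ => abs_nonneg _) hi))
      · simpa [hi] using Finset.sum_nonneg fun _ _ => abs_nonneg _)
  have e1 : ∏ i ∈ I, ∫ x, (if i ∈ I then f i else fun _ => 0) x ∂μ = ∏ i ∈ I, ∫ x, f i x ∂μ :=
    Finset.prod_congr rfl fun i hi => by simp [hi]
  have e2 : ∀ n, ∫ x, ∏ i ∈ I, (if i ∈ I then f i else fun _ => 0) (u (d i n) x) ∂μ
      = ∫ x, ∏ i ∈ I, f i (u (d i n) x) ∂μ := fun n =>
    integral_congr_ae (.of_forall fun x => Finset.prod_congr rfl fun i hi => by simp [hi])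
  simpa only [e1, e2] using key

/-! ### The dilation group and its normal subgroup -/

namespace DilationGroup

variable (lam : ℝ)

/-- The subgroup `Z₀` is homeomorphic to the real line. -/
noncomputable def realHomeomorph : ℝ ≃ₜ Z₀ lam where
  toFun v := ⟨SemidirectProduct.inl (.ofAdd v), .ofAdd v, rfl⟩
  invFun z := z.1.left.toAdd
  left_inv v := rfl
  right_inv := by
    rintro ⟨_, v, rfl⟩
    rfl
  continuous_toFun := by
    refine Continuous.subtype_mk (continuous_induced_rng.2 ?_) _
    exact (continuous_ofAdd).prodMk continuous_const
  continuous_invFun := by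
    have h : Continuous fun a : DilationGroup lam => (a.left, a.right) := continuous_induced_dom
    exact continuous_toAdd.comp (continuous_fst.comp (h.comp continuous_subtype_val))

theorem realHomeomorph_symm_mul_inv (a b : Z₀ lam) :
    (realHomeomorph lam).symm (a * b⁻¹)
      = (realHomeomorph lam).symm a - (realHomeomorph lam).symm b := by
  obtain ⟨_, v, rfl⟩ := a
  obtain ⟨_, w, rfl⟩ := b
  change ((SemidirectProduct.inl v * (SemidirectProduct.inl w)⁻¹ : DilationGroup lam)).left.toAdd
    = v.toAdd - w.toAdd
  rw [← map_inv, ← map_mul, SemidirectProduct.left_inl, ← div_eq_mul_inv, toAdd_div]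

theorem realHomeomorph_symm_pow (a : Z₀ lam) (n : ℕ) :
    (realHomeomorph lam).symm (a ^ n) = n * (realHomeomorph lam).symm a := by
  obtain ⟨_, v, rfl⟩ := a
  change ((SemidirectProduct.inl v ^ n : DilationGroup lam)).left.toAdd = n * v.toAdd
  rw [← map_pow, SemidirectProduct.left_inl, toAdd_pow, nsmul_eq_mul]

theorem tendsto_pow_cocompact {z : Z₀ lam} (hz : z ≠ 1) :
    Tendsto (fun n : ℕ => z ^ n) atTop (cocompact (Z₀ lam)) := by
  have hv : (realHomeomorph lam).symm z ≠ 0 := fun h => hz <| by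
    have := congrArg (realHomeomorph lam) h
    rw [Homeomorph.apply_symm_apply] at this
    exact this
  have h1 : Tendsto (fun n : ℕ => (n : ℝ) * (realHomeomorph lam).symm z) atTop (cocompact ℝ) :=
    (Homeomorph.mulRight₀ _ hv).isClosedEmbedding.tendsto_cocompact.comp
      (tendsto_natCast_atTop_atTop.mono_right atTop_le_cocompact)
  refine ((realHomeomorph lam).isClosedEmbedding.tendsto_cocompact.comp h1).congr fun n => ?_
  rw [Function.comp, ← realHomeomorph_symm_pow, Homeomorph.apply_symm_apply]

/-- One nontrivial element suffices, here translation by `1`: a set almost invariant under `Z₀` is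
almost invariant under it. -/
theorem ergodicSMul_of_ergodic {X : Type*} [MeasurableSpace X]
    [MulAction (DilationGroup lam) X] (μ : Measure X) [SMulInvariantMeasure (DilationGroup lam) X μ]
    (h : ∀ z : Z₀ lam, z ≠ 1 → Ergodic (fun x : X => z • x) μ) :
    ErgodicSMul (Z₀ lam) X μ where
  measure_preimage_smul z _ hs := measure_preimage_smul_of_nullMeasurableSet
    (c := (z : DilationGroup lam)) hs.nullMeasurableSet
  aeconst_of_forall_preimage_smul_ae_eq {s} hs hinv := by
    have hne : realHomeomorph lam 1 ≠ 1 := fun h1 => one_ne_zero (α := ℝ) <| by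
      have := congrArg (realHomeomorph lam).symm h1
      rwa [Homeomorph.symm_apply_apply] at this
    exact (h _ hne).quasiErgodic.aeconst_set₀ hs.nullMeasurableSet (hinv _)

variable {X : Type*} [MeasurableSpace X] [MulAction (DilationGroup lam) X]
  [MeasurableSMul₂ (DilationGroup lam) X] (μ : Measure X)
  [SMulInvariantMeasure (DilationGroup lam) X μ]

theorem isMeasurePreservingFlow_inl : IsMeasurePreservingFlow
    (fun v x => (SemidirectProduct.inl (.ofAdd v) : DilationGroup lam) • (x : X)) μ where
  measurable := by
    have h : Measurable fun v : ℝ => (SemidirectProduct.inl (.ofAdd v) : DilationGroup lam) :=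
      measurable_comap_iff.2 (measurable_id.prodMk measurable_const)
    exact (h.comp measurable_fst).smul measurable_snd
  measurePreserving _ := measurePreserving_smul _ μ
  zero x := by simp
  add s t x := by simp [mul_smul]

theorem isMeasurePreservingFlow_inr : IsMeasurePreservingFlow
    (fun t x => (SemidirectProduct.inr (.ofAdd t) : DilationGroup lam) • (x : X)) μ where
  measurable := by
    have h : Measurable fun v : ℝ => (SemidirectProduct.inr (.ofAdd v) : DilationGroup lam) :=
      measurable_comap_iff.2 (measurable_const.prodMk measurable_id)
    exact (h.comp measurable_fst).smul measurable_snd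
  measurePreserving _ := measurePreserving_smul _ μ
  zero x := by simp
  add s t x := by simp [mul_smul]

/-- The conjugation rule is the defining relation `g_t v g_t⁻¹ = e^{lam t} v` of the semidirect
product. -/
theorem isRenormalizedFlow (hlam : lam ≠ 0) : IsRenormalizedFlow
    (fun v x => (SemidirectProduct.inl (.ofAdd v) : DilationGroup lam) • (x : X))
    (fun t x => (SemidirectProduct.inr (.ofAdd t) : DilationGroup lam) • (x : X)) lam μ where
  flow := isMeasurePreservingFlow_inl lam μ
  dilation := isMeasurePreservingFlow_inr lam μ
  ne_zero := hlam
  conj t s x := by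
    have h := SemidirectProduct.inl_aut (φ := dilationHom lam) (.ofAdd t) (.ofAdd s)
    have h' : (SemidirectProduct.inl (.ofAdd (Real.exp (lam * t) * s)) : DilationGroup lam)
      = SemidirectProduct.inr (.ofAdd t) * SemidirectProduct.inl (.ofAdd s)
        * SemidirectProduct.inr (.ofAdd t)⁻¹ := h
    simp only [← mul_smul, h', map_inv, inv_mul_cancel_right]

variable [IsProbabilityMeasure μ]

theorem isMixingOfAllOrders_of_ergodicSMul (hlam : lam ≠ 0) (h : ErgodicSMul (Z₀ lam) X μ) :
    IsMixingOfAllOrders (Z₀ lam) μ := by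
  have hu := isRenormalizedFlow lam (X := X) μ hlam
  have hmix := fun (f h' : X → ℝ) (hf : IsBddMeasurable f) (hh : IsBddMeasurable h') =>
    hu.tendsto_integral_mul (fun A hA hinv => h.aeconst_of_forall_preimage_smul_ae_eq hA (by
      rintro ⟨_, v, rfl⟩
      exact hinv v.toAdd)) hf hh
  intro k hk f g hf hg hgg
  set e := realHomeomorph lam with he
  -- The untranslated `f k` receives time `0`. Divergence of each `g i` and of each `g i * (g j)⁻¹`
  -- then becomes the single condition that the differences `d i - d j` diverge.
  set d : ℕ → ℕ → ℝ := fun i n => if i = k then 0 else e.symm (g i n) with hd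
  have hmem : ∀ i ∈ Finset.Icc 1 k, i ≠ k → i ∈ Finset.Icc 1 (k - 1) := fun i hi hik => by
    simp only [Finset.mem_Icc] at hi ⊢
    omega
  have hlt : ∀ i ∈ Finset.Icc 1 k, ∀ j ∈ Finset.Icc 1 k, i < j →
      Tendsto (fun n => d i n - d j n) atTop (cocompact ℝ) := by
    intro i hi j hj hij
    have hik : i ≠ k := by
      simp only [Finset.mem_Icc] at hj
      omega
    by_cases hjk : j = k
    · simp only [hd, hik, hjk, if_true, if_false, sub_zero]
      exact e.symm.isClosedEmbedding.tendsto_cocompact.comp (hg i (hmem i hi hik))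
    · simp only [hd, hik, hjk, if_false, he, ← realHomeomorph_symm_mul_inv]
      exact e.symm.isClosedEmbedding.tendsto_cocompact.comp
        (hgg i (hmem i hi hik) j (hmem j hj hjk) hij)
  have hne : ∀ i ∈ Finset.Icc 1 k, ∀ j ∈ Finset.Icc 1 k, i ≠ j →
      Tendsto (fun n => d i n - d j n) atTop (cocompact ℝ) := by
    intro i hi j hj hij
    rcases hij.lt_or_gt with h1 | h1
    · exact hlt i hi j hj h1
    · refine ((Homeomorph.neg ℝ).isClosedEmbedding.tendsto_cocompact.comp
        (hlt j hj i hi h1)).congr fun n => ?_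
      simp
  have key := tendsto_integral_prod_comp_of_bddMeasurable (μ := μ) (l := atTop)
    (I := Finset.Icc 1 k) (k := k) (by omega) (by simp)
    (T := fun i n x => (SemidirectProduct.inl (.ofAdd (d i n)) : DilationGroup lam) • x)
    (fun i n => hu.flow.measurePreserving _)
    (fun g hg => hu.tendsto_integral_prod hmix _ hne hg) (fun i hi => (hf i hi).1)
  refine key.congr fun n => integral_congr_ae (.of_forall fun x => ?_)
  obtain ⟨m, rfl⟩ : ∃ m, k = m + 1 := ⟨k - 1, by omega⟩
  simp only [Nat.add_sub_cancel]
  rw [Finset.prod_Icc_succ_top (by omega)]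
  congr 1
  · refine Finset.prod_congr rfl fun i hi => ?_
    have hik : i ≠ m + 1 := by
      simp only [Finset.mem_Icc] at hi
      omega
    simp only [hd, hik, if_false]
    exact congrArg (fun z : Z₀ lam => f i (z • x)) (e.apply_symm_apply (g i n))
  · simp [hd]

/-- For an invariant set, the centred indicator `f` satisfies `f (z ^ n • x) = f x`, so its
correlation along the powers of `z` is constantly `∫ f ^ 2`. Mixing makes this `0`. -/
theorem ergodic_of_isMixingAction (h : IsMixingAction (Z₀ lam) μ) {z : Z₀ lam} (hz : z ≠ 1) :
    Ergodic (fun x : X => z • x) μ := by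
  refine ⟨measurePreserving_smul (z : DilationGroup lam) μ, ⟨fun s hs hinv => ?_⟩⟩
  set m := ∫ x, s.indicator (1 : X → ℝ) x ∂μ with hm
  set f : X → ℝ := fun x => s.indicator 1 x - m with hf
  have h1b : IsBddMeasurable (s.indicator (1 : X → ℝ)) :=
    ⟨measurable_one.indicator hs, 1, fun x => by by_cases hx : x ∈ s <;> simp [hx]⟩
  have hfb : IsBddMeasurable f := h1b.sub (.const m)
  have hf0 : ∫ x, f x ∂μ = 0 := by
    rw [hf, integral_sub (h1b.integrable μ) (integrable_const _)]
    simp [hm]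
  have hpow : ∀ (n : ℕ) x, f (z ^ n • x) = f x := by
    intro n
    induction n with
    | zero => simp
    | succ n ih =>
      intro x
      have hzx : z • x ∈ s ↔ x ∈ s := by
        conv_rhs => rw [← hinv]
        rfl
      rw [pow_succ, mul_smul, ih]
      by_cases hx : x ∈ s
      · simp [hf, hx, hzx.2 hx]
      · simp [hf, hx, mt hzx.1 hx]
  -- For `k = 2` there is one sequence, so the condition on pairs `i < j` is vacuous.
  have key := h (fun _ => f) (fun _ n => z ^ n) (fun i _ => ⟨hfb.memLp _ μ, hf0⟩)
    (fun i _ => tendsto_pow_cocompact lam hz)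
    (fun i hi j hj hij => by
      simp only [Finset.mem_Icc] at hi hj
      omega)
  have hsq : ∫ x, f x * f x ∂μ = 0 := by
    refine tendsto_nhds_unique (tendsto_const_nhds (f := (atTop : Filter ℕ))) ?_
    simpa [hpow, hf0] using key
  rw [integral_eq_zero_iff_of_nonneg (fun x => mul_self_nonneg _)
    ((hfb.mul hfb).integrable μ)] at hsq
  rw [eventuallyConst_set]
  -- The indicator equals `m` almost everywhere: `s` is conull if `m = 1`, and otherwise null.
  by_cases h1 : m = 1
  · left
    filter_upwards [hsq] with x hx
    by_contra hxs
    simp [hf, hxs, h1] at hx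
  · right
    filter_upwards [hsq] with x hx hxs
    have hx' : f x = 0 := mul_self_eq_zero.1 hx
    simp only [hf, Set.indicator_of_mem hxs, Pi.one_apply, sub_eq_zero] at hx'
    exact h1 hx'.symm

end DilationGroup

theorem proposition3p4 (lam : ℝ) (hlam : lam ≠ 0)
    {X : Type*} [MeasurableSpace X] [StandardBorelSpace X]
    [MulAction (DilationGroup lam) X] [MeasurableSMul₂ (DilationGroup lam) X]
    (μ : Measure X) [IsProbabilityMeasure μ] [SMulInvariantMeasure (DilationGroup lam) X μ] :
    List.TFAE [
      ErgodicSMul (DilationGroup.Z₀ lam) X μ,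
      IsMixingOfAllOrders (DilationGroup.Z₀ lam) μ,
      IsMixingAction (DilationGroup.Z₀ lam) μ,
      ∀ z : DilationGroup.Z₀ lam, z ≠ 1 → Ergodic (fun x : X => z • x) μ] := by
  tfae_have 1 → 2 := DilationGroup.isMixingOfAllOrders_of_ergodicSMul lam μ hlam
  tfae_have 2 → 3 := fun h => h 2 le_rfl
  tfae_have 3 → 4 := fun h _ hz => DilationGroup.ergodic_of_isMixingAction lam μ h hz
  tfae_have 4 → 1 := DilationGroup.ergodicSMul_of_ergodic lam μ
  tfae_finish
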